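/- Let $q,\beta,\gamma$ be complex numbers with $|q|<1$ and $|\beta|<1$. Put $(a;q)_n=\prod_{k=0}^{n-1}(1-aq^k)$ for integers $n\ge 0$, $(a;q)_\infty=\prod_{k=0}^{\infty}(1-aq^k)$ and $(a,b;q)_\infty=(a;q)_\infty(b;q)_\infty$. For $\theta\in\mathbb R$ let the continuous $q$-ultraspherical polynomials $C_n(\cos\theta;\beta|q)$ be defined by $$\frac{(\beta re^{i\theta},\beta re^{-i\theta};q)_\infty}{(re^{i\theta},re^{-i\theta};q)_\infty}=\sum_{n=0}^\infty C_n(\cos\theta;\beta|q)\,r^n\qquad(|r|<1),$$ and $C_n(\cos\theta;\gamma|q)$ likewise with $\gamma$ in place of $\beta$. Let $$\omega_\beta(\cos\theta|q)=\frac{(e^{2i\theta},e^{-2i\theta};q)_\infty}{(\beta e^{2i\theta},\beta e^{-2i\theta};q)_\infty},\qquad h_n(\beta|q)=\frac{(q,\beta^2;q)_\infty(q;q)_n(1-\beta q^n)}{2\pi(\beta,\beta q;q)_\infty(\beta^2;q)_n(1-\beta)}.$$ Then, for all integers $m,n\ge 0$, if $m\equiv n\pmod 2$ and $m\ge n$,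 $$\int_0^\pi C_m(\cos\theta;\gamma|q)\,C_n(\cos\theta;\beta|q)\,\omega_\beta(\cos\theta|q)\,d\theta=\frac{(1-\beta q^n)\,\beta^{\frac{m-n}2}(\gamma/\beta;q)_{\frac{m-n}2}(\gamma;q)_{\frac{m+n}2}}{(1-\beta)\,h_n(\beta|q)\,(q;q)_{\frac{m-n}2}(q\beta;q)_{\frac{m+n}2}},$$ and the integral is $0$ in all other cases (that is, if $m\not\equiv n\pmod 2$, or if $m<n$, where $1/(q;q)_{\frac{m-n}2}$ is read as $0$). Correspondingly, Rogers' connection formula holds: for all integers $n\ge0$ and all $\theta\in\mathbb R$, $$C_n(\cos\theta;\gamma|q)=\sum_{k=0}^{\lfloor n/2\rfloor}\frac{\beta^k(\gamma/\beta;q)_k(\gamma;q)_{n-k}(1-\beta q^{n-2k})}{(q;q)_k(\beta q;q)_{n-k}(1-\beta)}\,C_{n-2k}(\cos\theta;\beta|q).$$ In both formulas, for $\beta=0$ the product $\beta^k(\gamma/\beta;q)_k=\prod_{j=0}^{k-1}(\beta-\gamma q^j)$ is read as its value $(-\gamma)^kq^{k(k-1)/2}$. -/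

import Mathlib

/-- The finite `q`-shifted factorial `(a;q)_n = ∏_{k=0}^{n-1} (1 - a q^k)`. -/
noncomputable def qPoch (a q : ℂ) (n : ℕ) : ℂ :=
  ∏ k ∈ Finset.range n, (1 - a * q ^ k)

/-- The infinite `q`-shifted factorial `(a;q)_∞ = ∏_{k=0}^∞ (1 - a q^k)`
(the product converges absolutely for `|q| < 1`). -/
noncomputable def qPochInf (a q : ℂ) : ℂ :=
  ∏' k : ℕ, (1 - a * q ^ k)

/-- The generating function
`(β r e^{iθ}, β r e^{-iθ}; q)_∞ / (r e^{iθ}, r e^{-iθ}; q)_∞` as a function of `r`. -/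
noncomputable def ultraGen (q β : ℂ) (θ : ℝ) (r : ℂ) : ℂ :=
  (qPochInf (β * r * Complex.exp (θ * Complex.I)) q *
      qPochInf (β * r * Complex.exp (-(θ * Complex.I))) q) /
    (qPochInf (r * Complex.exp (θ * Complex.I)) q *
      qPochInf (r * Complex.exp (-(θ * Complex.I))) q)

/-- The continuous `q`-ultraspherical polynomial `C_n(cos θ; β | q)`: the coefficient of `r^n` in the
power series expansion of the generating function, which is analytic in `|r| < 1`. -/
noncomputable def ultraC (q β : ℂ) (n : ℕ) (θ : ℝ) : ℂ :=
  iteratedDeriv n (ultraGen q β θ) 0 / (Nat.factorial n : ℂ)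

/-- The weight `ω_β(cos θ | q) = (e^{2iθ}, e^{-2iθ}; q)_∞ / (β e^{2iθ}, β e^{-2iθ}; q)_∞`. -/
noncomputable def ultraWeight (q β : ℂ) (θ : ℝ) : ℂ :=
  (qPochInf (Complex.exp (2 * θ * Complex.I)) q *
      qPochInf (Complex.exp (-(2 * θ * Complex.I))) q) /
    (qPochInf (β * Complex.exp (2 * θ * Complex.I)) q *
      qPochInf (β * Complex.exp (-(2 * θ * Complex.I))) q)

/-- The normalisation
`h_n(β|q) = (q, β²; q)_∞ (q;q)_n (1 - β q^n) / (2π (β, βq; q)_∞ (β²;q)_n (1 - β))`. -/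
noncomputable def ultraH (q β : ℂ) (n : ℕ) : ℂ :=
  (qPochInf q q * qPochInf (β ^ 2) q * qPoch q q n * (1 - β * q ^ n)) /
    (2 * (Real.pi : ℂ) * (qPochInf β q * qPochInf (β * q) q) * qPoch (β ^ 2) q n * (1 - β))

open Classical in
/-- The factor `β^k (γ/β; q)_k = ∏_{j=0}^{k-1} (β - γ q^j)`, a polynomial in `β`; at `β = 0` it takes
the value `(-γ)^k q^{k(k-1)/2}` of that polynomial. -/
noncomputable def connFactor (q β γ : ℂ) (k : ℕ) : ℂ :=
  if β = 0 then (-γ) ^ k * q ^ (k * (k - 1) / 2) else β ^ k * qPoch (γ / β) q k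

open Filter Topology

/-! Everything rests on the `q`-binomial theorem in the homogeneous form `∑ ∏_{i<n} (b - a q^i) /
(q;q)_n = (a;q)_∞ / (b;q)_∞`, which never divides by `b`, so `β = 0` needs no separate treatment.
Applied to both factors of the generating function it writes `C_n` as a finite sum of exponentials
`e^{i(j-l)θ}` (`ultraC_eq_sum`).

Comparing the coefficients attached to each pair `(j, l)` turns Rogers' formula into a terminating
sum, evaluated by induction on `j` with a telescoping certificate (`sum_rogersTerm`).

For the integral, write the weight as `W(z) = (1 - z) Θ(z)` with `z = e^{2iθ}` and `Θ(z) = (qz, 1/z;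
q)_∞ / (βz, β/z; q)_∞`. The coefficients `θ_s` of `Θ` obey a first-order recurrence in `s`, and
`θ_0` is found by moving `β` to `βq` repeatedly. The case `γ = q` of Rogers' formula expands the
Chebyshev polynomials of the second kind, whose integrals against the weight are `2πθ_s`; this
forces `∫ C_n ω_β = 0` for `n ≥ 1`. The three-term recurrence upgrades this to orthogonality and
gives the norms `1 / h_n`. Integrating Rogers' formula against `C_n ω_β` then leaves a single term.
-/

/-! ### Nonvanishing and convergence of `q`-shifted factorials -/

theorem one_sub_mul_pow_ne_zero {q a : ℂ} (hq : ‖q‖ < 1) (ha : ‖a‖ < 1) (k : ℕ) :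
    1 - a * q ^ k ≠ 0 := by
  intro h
  have h1 : a * q ^ k = 1 := (sub_eq_zero.mp h).symm
  have h2 : ‖a * q ^ k‖ < 1 := by
    rw [norm_mul, norm_pow]
    exact (mul_le_of_le_one_right (norm_nonneg _) (pow_le_one₀ (norm_nonneg _) hq.le)).trans_lt ha
  rw [h1, norm_one] at h2
  exact lt_irrefl _ h2

theorem one_sub_pow_succ_ne_zero {q : ℂ} (hq : ‖q‖ < 1) (k : ℕ) : 1 - q ^ (k + 1) ≠ 0 := by
  have := one_sub_mul_pow_ne_zero hq hq k
  rwa [← pow_succ'] at this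

theorem qPoch_zero (a q : ℂ) : qPoch a q 0 = 1 := by simp [qPoch]

theorem qPoch_succ (a q : ℂ) (n : ℕ) : qPoch a q (n + 1) = qPoch a q n * (1 - a * q ^ n) := by
  simp [qPoch, Finset.prod_range_succ]

theorem qPoch_succ' (a q : ℂ) (n : ℕ) : qPoch a q (n + 1) = (1 - a) * qPoch (a * q) q n := by
  simp only [qPoch, Finset.prod_range_succ', pow_zero, mul_one]
  rw [mul_comm]
  congr 1
  exact Finset.prod_congr rfl fun i _ => by ring

theorem qPoch_self_succ (q : ℂ) (n : ℕ) :
    qPoch q q (n + 1) = qPoch q q n * (1 - q ^ (n + 1)) := by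
  rw [qPoch_succ, pow_succ']

theorem qPoch_ne_zero {q a : ℂ} (hq : ‖q‖ < 1) (ha : ‖a‖ < 1) (n : ℕ) : qPoch a q n ≠ 0 :=
  Finset.prod_ne_zero_iff.mpr fun k _ => one_sub_mul_pow_ne_zero hq ha k

theorem summable_norm_neg_mul_pow {q : ℂ} (hq : ‖q‖ < 1) (a : ℂ) :
    Summable fun k : ℕ => ‖-(a * q ^ k)‖ := by
  simp only [norm_neg, norm_mul, norm_pow]
  exact (summable_geometric_of_lt_one (norm_nonneg _) hq).mul_left _

theorem tendsto_qPoch {q : ℂ} (hq : ‖q‖ < 1) (a : ℂ) :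
    Tendsto (qPoch a q) atTop (𝓝 (qPochInf a q)) := by
  have h := (multipliable_one_add_of_summable (summable_norm_neg_mul_pow hq a)).hasProd
  simp only [← sub_eq_add_neg] at h
  exact h.tendsto_prod_nat

theorem qPochInf_ne_zero {q a : ℂ} (hq : ‖q‖ < 1) (ha : ‖a‖ < 1) : qPochInf a q ≠ 0 := by
  have h := tprod_one_add_ne_zero_of_summable (f := fun k : ℕ => -(a * q ^ k))
    (fun k => by rw [← sub_eq_add_neg]; exact one_sub_mul_pow_ne_zero hq ha k)
    (summable_norm_neg_mul_pow hq a)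
  simp only [← sub_eq_add_neg] at h
  exact h

/-! ### The `q`-binomial theorem in homogeneous form -/

/-- The homogeneous `q`-shifted factorial `∏_{i<n} (b - a q^i)`. -/
noncomputable def qBinProd (q b a : ℂ) (n : ℕ) : ℂ :=
  ∏ i ∈ Finset.range n, (b - a * q ^ i)

/-- The coefficients of the `q`-binomial theorem in homogeneous form. -/
noncomputable def qBinCoeff (q b a : ℂ) (n : ℕ) : ℂ :=
  qBinProd q b a n / qPoch q q n

theorem qBinProd_zero (q b a : ℂ) : qBinProd q b a 0 = 1 := by simp [qBinProd]

theorem qBinProd_succ (q b a : ℂ) (n : ℕ) :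
    qBinProd q b a (n + 1) = qBinProd q b a n * (b - a * q ^ n) := by
  simp [qBinProd, Finset.prod_range_succ]

theorem qBinProd_one (q a : ℂ) (n : ℕ) : qBinProd q 1 a n = qPoch a q n := rfl

theorem qBinProd_smul (q b a c : ℂ) (n : ℕ) :
    qBinProd q (b * c) (a * c) n = c ^ n * qBinProd q b a n := by
  rw [qBinProd, qBinProd, ← Finset.card_range n, ← Finset.prod_const, Finset.card_range,
    ← Finset.prod_mul_distrib]
  exact Finset.prod_congr rfl fun i _ => by ring

theorem connFactor_eq (q b a : ℂ) (n : ℕ) : connFactor q b a n = qBinProd q b a n := by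
  unfold connFactor
  split_ifs with hb
  · subst hb
    induction n with
    | zero => simp [qBinProd]
    | succ n ih =>
      rw [qBinProd_succ, ← ih]
      have : (n + 1) * (n + 1 - 1) / 2 = n * (n - 1) / 2 + n := by
        rw [← Finset.sum_range_id, ← Finset.sum_range_id, Finset.sum_range_succ]
      rw [this]
      ring
  · rw [← qBinProd_one]
    have := qBinProd_smul q 1 (a / b) b n
    rw [one_mul, div_mul_cancel₀ _ hb] at this
    exact this.symm

theorem qBinCoeff_zero (q b a : ℂ) : qBinCoeff q b a 0 = 1 := by
  simp [qBinCoeff, qBinProd, qPoch]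

theorem qBinCoeff_smul (q b a c : ℂ) (n : ℕ) :
    qBinCoeff q (b * c) (a * c) n = c ^ n * qBinCoeff q b a n := by
  rw [qBinCoeff, qBinProd_smul, mul_div_assoc, qBinCoeff]

theorem qBinCoeff_succ {q : ℂ} (hq : ‖q‖ < 1) (b a : ℂ) (n : ℕ) :
    qBinCoeff q b a (n + 1) * (1 - q ^ (n + 1)) = (b - a * q ^ n) * qBinCoeff q b a n := by
  have h1 := one_sub_pow_succ_ne_zero hq n
  have h2 := qPoch_ne_zero hq hq n
  rw [qBinCoeff, qBinCoeff, qBinProd_succ, qPoch_self_succ]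
  field_simp

/-- A majorant of `qBinCoeff`, uniform in its parameters. -/
noncomputable def qBinMajorant (q : ℂ) (ρ α : ℝ) (n : ℕ) : ℝ :=
  ∏ i ∈ Finset.range n, (ρ + α * ‖q‖ ^ i) / ‖1 - q ^ (i + 1)‖

theorem norm_qBinCoeff_le {q b a : ℂ} {ρ α : ℝ} (hb : ‖b‖ ≤ ρ) (ha : ‖a‖ ≤ α) (n : ℕ) :
    ‖qBinCoeff q b a n‖ ≤ qBinMajorant q ρ α n := by
  rw [qBinCoeff, qBinProd, qPoch, ← Finset.prod_div_distrib, norm_prod, qBinMajorant]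
  refine Finset.prod_le_prod (fun _ _ => norm_nonneg _) fun i _ => ?_
  rw [norm_div, ← pow_succ']
  gcongr
  refine (norm_sub_le _ _).trans ?_
  rw [norm_mul, norm_pow]
  gcongr

theorem qBinMajorant_nonneg (q : ℂ) {ρ α : ℝ} (hρ : 0 ≤ ρ) (hα : 0 ≤ α) (n : ℕ) :
    0 ≤ qBinMajorant q ρ α n :=
  Finset.prod_nonneg fun i _ => by positivity

/-- Ratio test: consecutive ratios tend to `ρ < 1`. Uniformity in the parameters is what later
allows `βq^N → 0` under a sum. -/
theorem summable_qBinMajorant {q : ℂ} (hq : ‖q‖ < 1) {ρ α : ℝ} (hρ : 0 ≤ ρ) (hρ1 : ρ < 1)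
    (hα : 0 ≤ α) : Summable (qBinMajorant q ρ α) := by
  have hlim : Tendsto (fun n : ℕ => (ρ + α * ‖q‖ ^ n) / ‖1 - q ^ (n + 1)‖) atTop (𝓝 ρ) := by
    have h1 : Tendsto (fun n : ℕ => ‖q‖ ^ n) atTop (𝓝 0) :=
      tendsto_pow_atTop_nhds_zero_of_lt_one (norm_nonneg _) hq
    have h2 : Tendsto (fun n : ℕ => q ^ (n + 1)) atTop (𝓝 0) :=
      (tendsto_pow_atTop_nhds_zero_of_norm_lt_one hq).comp (tendsto_add_atTop_nat 1)
    have h3 : Tendsto (fun n : ℕ => (ρ + α * ‖q‖ ^ n) / ‖1 - q ^ (n + 1)‖) atTop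
        (𝓝 ((ρ + α * 0) / ‖(1 : ℂ) - 0‖)) :=
      ((h1.const_mul α).const_add ρ).div (h2.const_sub 1).norm (by simp)
    simpa using h3
  obtain ⟨r, hr, hr1⟩ := exists_between hρ1
  refine summable_of_ratio_norm_eventually_le hr1 ?_
  filter_upwards [hlim.eventually (gt_mem_nhds hr)] with n hn
  rw [Real.norm_of_nonneg (qBinMajorant_nonneg q hρ hα _),
    Real.norm_of_nonneg (qBinMajorant_nonneg q hρ hα _)]
  unfold qBinMajorant
  rw [Finset.prod_range_succ, mul_comm]
  exact mul_le_mul_of_nonneg_right hn.le (qBinMajorant_nonneg q hρ hα n)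

theorem summable_norm_qBinCoeff {q b : ℂ} (hq : ‖q‖ < 1) (hb : ‖b‖ < 1) (a : ℂ) :
    Summable fun n => ‖qBinCoeff q b a n‖ :=
  (summable_qBinMajorant hq (norm_nonneg b) hb (norm_nonneg a)).of_nonneg_of_le
    (fun _ => norm_nonneg _) fun n => norm_qBinCoeff_le le_rfl le_rfl n

/-- With `F(z) = ∑ c_n z^n`, the recurrence for `c_n` says `F(z) - F(qz) = z (b F(z) - a F(qz))`;
this is the case `z = 1`. -/
theorem tsum_qBinCoeff_shift {q b : ℂ} (hq : ‖q‖ < 1) (hb : ‖b‖ < 1) (a : ℂ) :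
    (1 - b) * ∑' n, qBinCoeff q b a n =
      (1 - a) * ∑' n, qBinCoeff q (b * q) (a * q) n := by
  have hs := (summable_norm_qBinCoeff hq hb a).of_norm
  have hbq : ‖b * q‖ < 1 := by
    rw [norm_mul]
    exact (mul_le_of_le_one_right (norm_nonneg _) hq.le).trans_lt hb
  have hs' := (summable_norm_qBinCoeff hq hbq (a * q)).of_norm
  have key : ∀ n, qBinCoeff q b a (n + 1) - b * qBinCoeff q b a n =
      qBinCoeff q (b * q) (a * q) (n + 1) - a * qBinCoeff q (b * q) (a * q) n := by
    intro n
    rw [qBinCoeff_smul, qBinCoeff_smul]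
    linear_combination qBinCoeff_succ hq b a n
  have h0 := congrArg tsum (funext key)
  rw [((summable_nat_add_iff 1).mpr hs).tsum_sub (hs.mul_left b),
    ((summable_nat_add_iff 1).mpr hs').tsum_sub (hs'.mul_left a), tsum_mul_left,
    tsum_mul_left] at h0
  have h1 := hs.tsum_eq_zero_add
  have h2 := hs'.tsum_eq_zero_add
  rw [qBinCoeff_zero] at h1 h2
  linear_combination h0 + h1 - h2

/-- The `q`-binomial theorem. -/
theorem hasSum_qBinCoeff {q b : ℂ} (hq : ‖q‖ < 1) (hb : ‖b‖ < 1) (a : ℂ) :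
    HasSum (qBinCoeff q b a) (qPochInf a q / qPochInf b q) := by
  have hs := summable_norm_qBinCoeff hq hb a
  -- The shift is iterated `N` times; as `N → ∞` both parameters tend to `0` and only the term `n =
  -- 0` of the shifted series survives.
  have hN : ∀ N : ℕ, qPoch b q N * ∑' n, qBinCoeff q b a n =
      qPoch a q N * ∑' n, qBinCoeff q (b * q ^ N) (a * q ^ N) n := by
    intro N
    induction N with
    | zero => simp [qPoch]
    | succ N ih =>
      have hbN : ‖b * q ^ N‖ < 1 := by
        rw [norm_mul, norm_pow]
        exact (mul_le_of_le_one_right (norm_nonneg _)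
          (pow_le_one₀ (norm_nonneg _) hq.le)).trans_lt hb
      have h := tsum_qBinCoeff_shift hq hbN (a * q ^ N)
      rw [qPoch_succ, qPoch_succ, pow_succ, ← mul_assoc, ← mul_assoc]
      linear_combination (1 - b * q ^ N) * ih + qPoch a q N * h
  have hlim : Tendsto (fun N : ℕ => ∑' n, qBinCoeff q (b * q ^ N) (a * q ^ N) n) atTop (𝓝 1) := by
    have hone : (1 : ℂ) = ∑' n : ℕ, if n = 0 then 1 else 0 := by simp
    rw [hone]
    refine tendsto_tsum_of_dominated_convergence (bound := fun n => ‖qBinCoeff q b a n‖) hs ?_ ?_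
    · intro n
      rcases n with _ | n
      · simp [qBinCoeff_zero]
      · simp only [qBinCoeff_smul]
        have h1 : Tendsto (fun N : ℕ => (q ^ (n + 1)) ^ N) atTop (𝓝 0) := by
          refine tendsto_pow_atTop_nhds_zero_of_norm_lt_one ?_
          rw [norm_pow]
          exact pow_lt_one₀ (norm_nonneg _) hq (Nat.succ_ne_zero n)
        have h2 := h1.mul_const (qBinCoeff q b a (n + 1))
        simpa [← pow_mul, mul_comm] using h2
    · filter_upwards with N n
      rw [qBinCoeff_smul, norm_mul, norm_pow, norm_pow]
      exact mul_le_of_le_one_left (norm_nonneg _)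
        (pow_le_one₀ (by positivity) (pow_le_one₀ (norm_nonneg _) hq.le))
  have h1 := (tendsto_qPoch hq b).mul_const (∑' n, qBinCoeff q b a n)
  have h2 := (tendsto_qPoch hq a).mul hlim
  rw [← funext hN, mul_one] at h2
  have h3 := tendsto_nhds_unique h1 h2
  rw [← h3, mul_div_cancel_left₀ _ (qPochInf_ne_zero hq hb)]
  exact hs.of_norm.hasSum

/-! ### Fourier expansion, parity and three-term recurrence of `C_n` -/

/-- The Fourier expansion of the continuous `q`-ultraspherical polynomials. -/
theorem ultraC_eq_sum {q : ℂ} (hq : ‖q‖ < 1) (β : ℂ) (n : ℕ) (θ : ℝ) :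
    ultraC q β n θ = ∑ p ∈ Finset.HasAntidiagonal.antidiagonal n,
      qBinCoeff q 1 β p.1 * qBinCoeff q 1 β p.2 *
        Complex.exp (((p.1 : ℂ) - (p.2 : ℂ)) * (θ * Complex.I)) := by
  set c : ℕ → ℂ := fun n => ∑ p ∈ Finset.HasAntidiagonal.antidiagonal n,
      qBinCoeff q 1 β p.1 * qBinCoeff q 1 β p.2 *
        Complex.exp (((p.1 : ℂ) - (p.2 : ℂ)) * (θ * Complex.I)) with hc
  have hn1 : ‖Complex.exp (θ * Complex.I)‖ = 1 := Complex.norm_exp_ofReal_mul_I θ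
  have hn2 : ‖Complex.exp (-(θ * Complex.I))‖ = 1 := by
    rw [Complex.exp_neg, norm_inv, hn1, inv_one]
  have hser : HasFPowerSeriesAt (ultraGen q β θ) (FormalMultilinearSeries.ofScalars ℂ c) 0 := by
    rw [hasFPowerSeriesAt_iff]
    filter_upwards [Metric.ball_mem_nhds (0 : ℂ) one_pos] with r hr
    rw [mem_ball_zero_iff] at hr
    have h1 : ‖r * Complex.exp (θ * Complex.I)‖ < 1 := by rwa [norm_mul, hn1, mul_one]
    have h2 : ‖r * Complex.exp (-(θ * Complex.I))‖ < 1 := by rwa [norm_mul, hn2, mul_one]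
    have s1 := summable_norm_qBinCoeff hq h1 (β * r * Complex.exp (θ * Complex.I))
    have s2 := summable_norm_qBinCoeff hq h2 (β * r * Complex.exp (-(θ * Complex.I)))
    have hs := (summable_norm_sum_mul_antidiagonal_of_summable_norm s1 s2).of_norm.hasSum
    rw [← tsum_mul_tsum_eq_tsum_sum_antidiagonal_of_summable_norm s1 s2,
      (hasSum_qBinCoeff hq h1 _).tsum_eq, (hasSum_qBinCoeff hq h2 _).tsum_eq,
      div_mul_div_comm] at hs
    rw [zero_add, ultraGen]
    convert hs using 2 with n
    rw [FormalMultilinearSeries.coeff_ofScalars, hc, smul_eq_mul, Finset.mul_sum]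
    refine Finset.sum_congr rfl fun p hp => ?_
    have e1 := qBinCoeff_smul q 1 β (r * Complex.exp (θ * Complex.I)) p.1
    have e2 := qBinCoeff_smul q 1 β (r * Complex.exp (-(θ * Complex.I))) p.2
    rw [one_mul, ← mul_assoc] at e1 e2
    rw [e1, e2, mul_pow, mul_pow, ← Complex.exp_nat_mul, ← Complex.exp_nat_mul,
      ← Finset.HasAntidiagonal.mem_antidiagonal.mp hp, pow_add, sub_mul, sub_eq_add_neg, Complex.exp_add,
      mul_neg]
    ring
  -- Uniqueness of power series: the Taylor series, whose coefficients define `ultraC`, equals the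
  -- Cauchy product.
  have h := hser.analyticAt.hasFPowerSeriesAt.eq_formalMultilinearSeries hser
  have := congrArg (fun p => FormalMultilinearSeries.coeff p n) h
  simp only [FormalMultilinearSeries.coeff_ofScalars] at this
  exact this

theorem continuous_ultraC {q : ℂ} (hq : ‖q‖ < 1) (β : ℂ) (n : ℕ) : Continuous (ultraC q β n) := by
  rw [funext (ultraC_eq_sum hq β n)]
  fun_prop

theorem ultraC_zero {q : ℂ} (hq : ‖q‖ < 1) (β : ℂ) (θ : ℝ) : ultraC q β 0 θ = 1 := by
  simp [ultraC_eq_sum hq, qBinCoeff_zero]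

theorem ultraC_pi_sub {q : ℂ} (hq : ‖q‖ < 1) (β : ℂ) (n : ℕ) (θ : ℝ) :
    ultraC q β n (Real.pi - θ) = (-1) ^ n * ultraC q β n θ := by
  rw [ultraC_eq_sum hq, ultraC_eq_sum hq, ← Finset.Nat.sum_antidiagonal_swap, Finset.mul_sum]
  refine Finset.sum_congr rfl fun p hp => ?_
  have e : Complex.exp (((p.2 : ℂ) - (p.1 : ℂ)) * (((Real.pi - θ : ℝ) : ℂ) * Complex.I)) =
      (-1) ^ n * Complex.exp (((p.1 : ℂ) - (p.2 : ℂ)) * (θ * Complex.I)) := by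
    have : ((p.2 : ℂ) - (p.1 : ℂ)) * (((Real.pi - θ : ℝ) : ℂ) * Complex.I) =
        (p.2 : ℕ) * (Real.pi * Complex.I) + (-((p.1 : ℕ) * (Real.pi * Complex.I)) +
          ((p.1 : ℂ) - (p.2 : ℂ)) * (θ * Complex.I)) := by
      push_cast; ring
    rw [this, Complex.exp_add, Complex.exp_add, Complex.exp_neg, Complex.exp_nat_mul,
      Complex.exp_nat_mul, Complex.exp_pi_mul_I, ← Finset.HasAntidiagonal.mem_antidiagonal.mp hp, pow_add,
      ← inv_pow]
    norm_num
    ring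
  simp only [Prod.fst_swap, Prod.snd_swap, e]
  ring

/-- The three-term recurrence relation. -/
theorem ultraC_recurrence {q : ℂ} (hq : ‖q‖ < 1) (β : ℂ) (n : ℕ) (θ : ℝ) :
    (1 - β * q ^ (n + 1)) * (2 * Complex.cos θ) * ultraC q β (n + 1) θ =
      (1 - q ^ (n + 2)) * ultraC q β (n + 2) θ + (1 - β ^ 2 * q ^ n) * ultraC q β n θ := by
  set z := Complex.exp (θ * Complex.I) with hz
  have hz0 : z ≠ 0 := Complex.exp_ne_zero _
  have hcos : 2 * Complex.cos θ = z + z⁻¹ := by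
    rw [Complex.cos, hz, ← Complex.exp_neg, neg_mul]; ring
  set A := qBinCoeff q 1 β with hA
  have hC : ∀ m, ultraC q β m θ = ∑ p ∈ Finset.HasAntidiagonal.antidiagonal m, A p.1 * A p.2 * (z ^ p.1 / z ^ p.2) := by
    intro m
    rw [ultraC_eq_sum hq]
    refine Finset.sum_congr rfl fun p _ => ?_
    rw [sub_mul, Complex.exp_sub, Complex.exp_nat_mul, Complex.exp_nat_mul]
  have hrec : ∀ m, A (m + 1) * (1 - q ^ (m + 1)) = (1 - β * q ^ m) * A m := qBinCoeff_succ hq 1 β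
  have hA0 : A 0 = 1 := qBinCoeff_zero q 1 β
  -- multiplication by `z` and by `z⁻¹`, as sums over `antidiagonal (n + 2)`
  have hup : z * ultraC q β (n + 1) θ = ∑ p ∈ Finset.HasAntidiagonal.antidiagonal (n + 2),
      (if p.1 = 0 then 0 else A (p.1 - 1) * A p.2 * (z ^ p.1 / z ^ p.2)) := by
    rw [hC, Finset.mul_sum, Finset.Nat.sum_antidiagonal_succ (n := n + 1)]
    simp only [if_true, zero_add, Nat.succ_ne_zero, if_false, Nat.add_sub_cancel]
    exact Finset.sum_congr rfl fun p _ => by rw [pow_succ]; ring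
  have hdown : z⁻¹ * ultraC q β (n + 1) θ = ∑ p ∈ Finset.HasAntidiagonal.antidiagonal (n + 2),
      (if p.2 = 0 then 0 else A p.1 * A (p.2 - 1) * (z ^ p.1 / z ^ p.2)) := by
    rw [hC, Finset.mul_sum, Finset.Nat.sum_antidiagonal_succ' (n := n + 1)]
    simp only [if_true, zero_add, Nat.succ_ne_zero, if_false, Nat.add_sub_cancel]
    exact Finset.sum_congr rfl fun p _ => by rw [pow_succ]; field_simp
  have hmid : ultraC q β n θ = ∑ p ∈ Finset.HasAntidiagonal.antidiagonal (n + 2),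
      (if p.1 = 0 ∨ p.2 = 0 then 0 else A (p.1 - 1) * A (p.2 - 1) * (z ^ p.1 / z ^ p.2)) := by
    rw [hC, Finset.Nat.sum_antidiagonal_succ, Finset.Nat.sum_antidiagonal_succ']
    simp only [if_true, zero_add, Nat.succ_ne_zero, if_false, Nat.add_sub_cancel,
      true_or, or_true, or_self]
    exact Finset.sum_congr rfl fun p _ => by rw [pow_succ, pow_succ]; field_simp
  have hsum : (1 - β * q ^ (n + 1)) * (z * ultraC q β (n + 1) θ + z⁻¹ * ultraC q β (n + 1) θ) =
      (1 - q ^ (n + 2)) * ultraC q β (n + 2) θ + (1 - β ^ 2 * q ^ n) * ultraC q β n θ := by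
    rw [hup, hdown, hmid, hC (n + 2), ← Finset.sum_add_distrib, Finset.mul_sum, Finset.mul_sum,
      Finset.mul_sum, ← Finset.sum_add_distrib]
    refine Finset.sum_congr rfl fun p hp => ?_
    rw [Finset.HasAntidiagonal.mem_antidiagonal] at hp
    rcases p with ⟨j, l⟩
    simp only at hp ⊢
    -- On the boundary `j = 0` or `l = 0` only one of the two shifted sums contributes; in the
    -- interior all four terms are rational multiples of `A j * A l`.
    rcases j with _ | j
    · obtain rfl : l = n + 1 + 1 := by omega
      simp only [if_true, Nat.succ_ne_zero, if_false, Nat.add_sub_cancel, true_or, hA0]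
      linear_combination (-(z ^ 0 / z ^ (n + 2))) * hrec (n + 1)
    · rcases l with _ | l
      · obtain rfl : j = n + 1 := by omega
        simp only [if_true, Nat.succ_ne_zero, if_false, Nat.add_sub_cancel, or_true, hA0]
        linear_combination (-(z ^ (n + 2) / z ^ 0)) * hrec (n + 1)
      · obtain rfl : n = j + l := by omega
        simp only [Nat.succ_ne_zero, if_false, Nat.add_sub_cancel, or_self]
        have hj := one_sub_pow_succ_ne_zero hq j
        have hl := one_sub_pow_succ_ne_zero hq l
        have ej : A (j + 1) = (1 - β * q ^ j) * A j / (1 - q ^ (j + 1)) := by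
          rw [eq_div_iff hj, hrec]
        have el : A (l + 1) = (1 - β * q ^ l) * A l / (1 - q ^ (l + 1)) := by
          rw [eq_div_iff hl, hrec]
        rw [ej, el]
        generalize z ^ (j + 1) / z ^ (l + 1) = w
        field_simp
        ring
  rw [hcos]
  linear_combination hsum

/-! ### Rogers' connection formula -/

/-- The contribution of the `k`-th term of Rogers' connection formula to the Fourier coefficient
of index `j - l`. -/
noncomputable def rogersTerm (q β γ : ℂ) (j l k : ℕ) : ℂ :=
  qBinProd q β γ k * qPoch γ q (j + l - k) * (1 - β * q ^ (j + l - 2 * k)) /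
      (qPoch q q k * qPoch β q (j + l - k + 1)) *
    (qBinCoeff q 1 β (j - k) * qBinCoeff q 1 β (l - k))

/-- The telescoping certificate for the sum of `rogersTerm`. -/
theorem sum_rogersTerm_telescope {q β : ℂ} (hq : ‖q‖ < 1) (hβ : ‖β‖ < 1) (γ : ℂ) {j l K : ℕ}
    (hK : K ≤ j) (hjl : j < l) :
    ∑ k ∈ Finset.range (K + 1), ((1 - q ^ (j + 1)) * rogersTerm q β γ (j + 1) l k -
        (1 - γ * q ^ j) * rogersTerm q β γ j l k) =
      -q ^ (j - K) * qBinProd q β γ (K + 1) * qPoch γ q (j + l - K) /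
          (qPoch q q K * qPoch β q (j + l - K + 1)) *
        (qBinCoeff q 1 β (j - K) * qBinCoeff q 1 β (l - K) * (1 - q ^ (l - K))) := by
  induction K with
  | zero =>
    have h1 := one_sub_pow_succ_ne_zero hq j
    have e1 := qBinCoeff_succ hq 1 β j
    have e2 : j + 1 + l = j + l + 1 := by omega
    have n1 := qPoch_ne_zero hq hβ (j + l)
    have n2 := one_sub_mul_pow_ne_zero hq hβ (j + l)
    have n3 := one_sub_mul_pow_ne_zero hq hβ (j + l + 1)
    simp only [zero_add, Finset.sum_range_one, rogersTerm, Nat.sub_zero, mul_zero, qBinProd_succ,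
      qBinProd_zero, qPoch_zero, e2, qPoch_succ _ _ (j + l + 1), qPoch_succ _ _ (j + l), one_mul,
      pow_zero, mul_one]
    rw [eq_div_of_mul_eq h1 e1]
    field_simp
    ring
  | succ K ih =>
    obtain ⟨a, rfl⟩ := Nat.exists_eq_add_of_le hK
    obtain ⟨c, rfl⟩ := Nat.exists_eq_add_of_le (hK.trans hjl.le)
    rw [Finset.sum_range_succ, ih (by omega)]
    have i1 : K + 1 + a + (K + 1 + c) - K = K + a + c + 2 := by omega
    have i2 : K + 1 + a + (K + 1 + c) - (K + 1) = K + a + c + 1 := by omega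
    have i3 : K + 1 + a + 1 + (K + 1 + c) - (K + 1) = K + a + c + 2 := by omega
    have i4 : K + 1 + a + 1 + (K + 1 + c) - 2 * (K + 1) = a + c + 1 := by omega
    have i5 : K + 1 + a + (K + 1 + c) - 2 * (K + 1) = a + c := by omega
    have i6 : K + 1 + a - K = a + 1 := by omega
    have i7 : K + 1 + c - K = c + 1 := by omega
    have i8 : K + 1 + a + 1 - (K + 1) = a + 1 := by omega
    have i9 : K + 1 + a - (K + 1) = a := by omega
    have i10 : K + 1 + c - (K + 1) = c := by omega
    simp only [rogersTerm, i1, i2, i3, i4, i5, i6, i7, i8, i9, i10]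
    have h1 := one_sub_pow_succ_ne_zero hq a
    have h2 := one_sub_pow_succ_ne_zero hq c
    have h3 := one_sub_pow_succ_ne_zero hq K
    have n0 := qPoch_ne_zero hq hq K
    have n1 := qPoch_ne_zero hq hβ (K + a + c + 1)
    have n2 := one_sub_mul_pow_ne_zero hq hβ (K + a + c + 1)
    have n3 := one_sub_mul_pow_ne_zero hq hβ (K + a + c + 2)
    rw [eq_div_of_mul_eq h1 (qBinCoeff_succ hq 1 β a), eq_div_of_mul_eq h2 (qBinCoeff_succ hq 1 β c),
      qPoch_succ β q (K + a + c + 2), qPoch_succ β q (K + a + c + 1),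
      qPoch_succ γ q (K + a + c + 1), qPoch_self_succ q K, qBinProd_succ _ _ _ (K + 1)]
    field_simp
    ring

theorem sum_rogersTerm {q β : ℂ} (hq : ‖q‖ < 1) (hβ : ‖β‖ < 1) (γ : ℂ) {j l : ℕ} (hjl : j ≤ l) :
    ∑ k ∈ Finset.range (j + 1), rogersTerm q β γ j l k =
      qBinCoeff q 1 γ j * qBinCoeff q 1 γ l := by
  induction j with
  | zero =>
    have n1 := qPoch_ne_zero hq hβ l
    have n2 := one_sub_mul_pow_ne_zero hq hβ l
    have n3 := qPoch_ne_zero hq hq l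
    simp only [zero_add, Finset.sum_range_one, rogersTerm, Nat.sub_zero, mul_zero, qBinProd_zero,
      qPoch_zero, qPoch_succ, qBinCoeff_zero, one_mul]
    rw [qBinCoeff, qBinCoeff, qBinProd_one, qBinProd_one]
    field_simp
  | succ j ih =>
    obtain ⟨c, rfl⟩ := Nat.exists_eq_add_of_le hjl
    have hj := one_sub_pow_succ_ne_zero hq j
    -- The certificate at `K = j` leaves a boundary term, cancelled exactly by the extra summand `k
    -- = j + 1` (`hlast`). What remains is the first-order recurrence in `j` satisfied by the
    -- right-hand side.
    have h := sum_rogersTerm_telescope hq hβ γ le_rfl (Nat.lt_of_succ_le hjl)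
    rw [Finset.sum_sub_distrib, ← Finset.mul_sum, ← Finset.mul_sum, ih (by omega)] at h
    rw [Finset.sum_range_succ]
    refine mul_left_cancel₀ hj ?_
    have i1 : j + (j + 1 + c) - j = j + c + 1 := by omega
    have i2 : j + 1 + (j + 1 + c) - (j + 1) = j + c + 1 := by omega
    have i3 : j + 1 + (j + 1 + c) - 2 * (j + 1) = c := by omega
    have i4 : j + 1 + c - j = c + 1 := by omega
    have i5 : j + 1 + c - (j + 1) = c := by omega
    have hlast : (1 - q ^ (j + 1)) * rogersTerm q β γ (j + 1) (j + 1 + c) (j + 1) =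
        qBinProd q β γ (j + 1) * qPoch γ q (j + c + 1) /
          (qPoch q q j * qPoch β q (j + c + 1 + 1)) * (1 - β * q ^ c) * qBinCoeff q 1 β c := by
      have n0 := qPoch_ne_zero hq hq j
      have n1 := qPoch_ne_zero hq hβ (j + c + 1 + 1)
      rw [rogersTerm, i2, i3, i5, Nat.sub_self, qBinCoeff_zero, qPoch_self_succ]
      field_simp
    have hc := qBinCoeff_succ hq 1 β c
    have hg := qBinCoeff_succ hq 1 γ j
    rw [i1, i4, Nat.sub_self, qBinCoeff_zero, pow_zero] at h
    linear_combination h + hlast + qBinCoeff q 1 γ (j + 1 + c) * (-hg) -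
      qBinProd q β γ (j + 1) * qPoch γ q (j + c + 1) /
          (qPoch q q j * qPoch β q (j + c + 1 + 1)) * hc

/-- Rogers' connection formula. -/
theorem ultraC_connection {q β : ℂ} (hq : ‖q‖ < 1) (hβ : ‖β‖ < 1) (γ : ℂ) (n : ℕ) (θ : ℝ) :
    ultraC q γ n θ = ∑ k ∈ Finset.range (n / 2 + 1),
      (qBinProd q β γ k * qPoch γ q (n - k) * (1 - β * q ^ (n - 2 * k))) /
        (qPoch q q k * qPoch (β * q) q (n - k) * (1 - β)) * ultraC q β (n - 2 * k) θ := by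
  have hterm : ∀ j l, ∑ k ∈ Finset.range (min j l + 1), rogersTerm q β γ j l k =
      qBinCoeff q 1 γ j * qBinCoeff q 1 γ l := by
    intro j l
    rcases le_total j l with h | h
    · rw [min_eq_left h, sum_rogersTerm hq hβ γ h]
    · rw [min_eq_right h, mul_comm, ← sum_rogersTerm hq hβ γ h]
      refine Finset.sum_congr rfl fun k _ => ?_
      rw [rogersTerm, rogersTerm, add_comm j l, mul_comm (qBinCoeff q 1 β (j - k))]
  rw [ultraC_eq_sum hq]
  simp only [ultraC_eq_sum hq β, Finset.mul_sum, ← hterm, Finset.sum_mul]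
  rw [Finset.sum_sigma', Finset.sum_sigma']
  -- Subtracting `k` from both indices preserves `j - l`, hence the exponential.
  refine Finset.sum_nbij' (fun x => ⟨x.2, (x.1.1 - x.2, x.1.2 - x.2)⟩)
    (fun y => ⟨(y.2.1 + y.1, y.2.2 + y.1), y.1⟩) ?_ ?_ ?_ ?_ ?_
  · rintro ⟨⟨j, l⟩, k⟩ h
    simp only [Finset.mem_sigma, Finset.HasAntidiagonal.mem_antidiagonal, Finset.mem_range] at h ⊢
    omega
  · rintro ⟨k, ⟨j, l⟩⟩ h
    simp only [Finset.mem_sigma, Finset.HasAntidiagonal.mem_antidiagonal, Finset.mem_range] at h ⊢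
    omega
  · rintro ⟨⟨j, l⟩, k⟩ h
    simp only [Finset.mem_sigma, Finset.HasAntidiagonal.mem_antidiagonal, Finset.mem_range] at h
    have h1 : j - k + k = j := by omega
    have h2 : l - k + k = l := by omega
    simp only [h1, h2]
  · rintro ⟨k, ⟨j, l⟩⟩ h
    simp
  · rintro ⟨⟨j, l⟩, k⟩ h
    simp only [Finset.mem_sigma, Finset.HasAntidiagonal.mem_antidiagonal, Finset.mem_range] at h
    obtain ⟨rfl, h⟩ := h
    have hj : k ≤ j := by omega
    have hl : k ≤ l := by omega
    -- `rogersTerm` carries `(β;q)_{n-k+1}`, which is `(1 - β)(βq;q)_{n-k}`.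
    simp only [rogersTerm, qPoch_succ', Nat.cast_sub hj, Nat.cast_sub hl, sub_sub_sub_cancel_right]
    ring

/-! ### Fourier coefficients of the weight -/

theorem tsum_eq_of_telescoping {f D : ℕ → ℂ} (hf : Summable f) (h : ∀ n, f n = D n - D (n + 1))
    (hD : Tendsto D atTop (𝓝 0)) : ∑' n, f n = D 0 := by
  have h1 := hf.hasSum.tendsto_sum_nat
  have h2 : Tendsto (fun n => ∑ i ∈ Finset.range n, f i) atTop (𝓝 (D 0 - 0)) := by
    simp only [h, Finset.sum_range_sub']
    exact hD.const_sub (D 0)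
  rw [tendsto_nhds_unique h1 h2, sub_zero]

theorem summable_norm_mul_shift {f g : ℕ → ℂ} (hf : Summable fun n => ‖f n‖)
    (hg : Summable fun n => ‖g n‖) (s t : ℕ) : Summable fun n => f (n + s) * g (n + t) := by
  have hi : Function.Injective fun n : ℕ => (n + s, n + t) := fun m n h =>
    Nat.add_right_cancel (congrArg Prod.fst h)
  have h := (summable_mul_of_summable_norm hf hg).comp_injective hi
  simpa only [Function.comp_def] using h

theorem norm_mul_lt_one_of_lt_one {q β : ℂ} (hq : ‖q‖ < 1) (hβ : ‖β‖ < 1) : ‖β * q‖ < 1 := by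
  rw [norm_mul]
  exact (mul_le_of_le_one_right (norm_nonneg _) hq.le).trans_lt hβ

theorem norm_mul_pow_le {q : ℂ} (hq : ‖q‖ < 1) (β : ℂ) (N : ℕ) : ‖β * q ^ N‖ ≤ ‖β‖ := by
  rw [norm_mul, norm_pow]
  exact mul_le_of_le_one_right (norm_nonneg _) (pow_le_one₀ (norm_nonneg _) hq.le)

theorem norm_sq_lt_one {β : ℂ} (hβ : ‖β‖ < 1) : ‖β ^ 2‖ < 1 := by
  rw [norm_pow]
  exact pow_lt_one₀ (norm_nonneg _) hβ two_ne_zero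

/-- Coefficient form of `(z;q)_∞ = (1 - z)(qz;q)_∞`, divided by `(βz;q)_∞`. -/
theorem qBinCoeff_one_succ {q : ℂ} (hq : ‖q‖ < 1) (β : ℂ) (n : ℕ) :
    qBinCoeff q β 1 (n + 1) = qBinCoeff q β q (n + 1) - qBinCoeff q β q n := by
  have h1 := one_sub_pow_succ_ne_zero hq n
  have h2 := qPoch_ne_zero hq hq n
  have h3 : qBinProd q β 1 (n + 1) = (β - 1) * qBinProd q β q n := by
    simp only [qBinProd, Finset.prod_range_succ', pow_zero, mul_one]
    rw [mul_comm]
    congr 1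
    exact Finset.prod_congr rfl fun i _ => by ring
  rw [qBinCoeff, qBinCoeff, qBinCoeff, h3, qPoch_self_succ, qBinProd_succ]
  field_simp
  ring

/-- The Fourier coefficients of `(qz, 1/z; q)_∞ / (βz, β/z; q)_∞`. -/
noncomputable def thetaCoeff (q β : ℂ) (s : ℕ) : ℂ :=
  ∑' n, qBinCoeff q β q (n + s) * qBinCoeff q β 1 n

/-- The Fourier coefficients of the weight `(z, 1/z; q)_∞ / (βz, β/z; q)_∞`. -/
noncomputable def weightCoeff (q β : ℂ) (s : ℕ) : ℂ :=
  ∑' n, qBinCoeff q β 1 n * qBinCoeff q β 1 (n + s)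

section
variable {q β : ℂ} (hq : ‖q‖ < 1) (hβ : ‖β‖ < 1)
include hq hβ

theorem summable_thetaCoeff (s : ℕ) :
    Summable fun n => qBinCoeff q β q (n + s) * qBinCoeff q β 1 n :=
  summable_norm_mul_shift (summable_norm_qBinCoeff hq hβ q) (summable_norm_qBinCoeff hq hβ 1) s 0

theorem tendsto_qBinCoeff (a : ℂ) : Tendsto (qBinCoeff q β a) atTop (𝓝 0) :=
  (summable_norm_qBinCoeff hq hβ a).of_norm.tendsto_atTop_zero

/-- Formally this is the functional equation `(β - qz) Θ(qz) = (1 - βz) Θ(z)`. The proof telescopes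
instead, so it needs no common annulus of convergence. -/
theorem thetaCoeff_succ (s : ℕ) :
    thetaCoeff q β (s + 1) * (1 - β * q ^ (s + 1)) = thetaCoeff q β s * (β - q ^ (s + 1)) := by
  have hs := (summable_thetaCoeff hq hβ (s + 1)).mul_right (1 - β * q ^ (s + 1))
  have hs' := (summable_thetaCoeff hq hβ s).mul_right (β - q ^ (s + 1))
  have ha := tendsto_qBinCoeff hq hβ q
  have hb := tendsto_qBinCoeff hq hβ 1
  -- The telescoping sequence; its factor `1 - q^n` makes it vanish at `n = 0`, so the whole sum is
  -- zero.
  have hD : Tendsto (fun n => q ^ (s + 1) *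
      ((1 - q ^ n) * qBinCoeff q β 1 n * qBinCoeff q β q (n + s))) atTop (𝓝 0) := by
    have h := ((((tendsto_pow_atTop_nhds_zero_of_norm_lt_one hq).const_sub 1).mul hb).mul
      (ha.comp (tendsto_add_atTop_nat s))).const_mul (q ^ (s + 1))
    simpa using h
  have h := tsum_eq_of_telescoping (hs.sub hs') (fun n => ?_) hD
  · rw [hs.tsum_sub hs', tsum_mul_right, tsum_mul_right] at h
    rw [← sub_eq_zero, thetaCoeff, thetaCoeff, h]
    simp
  · have e1 := qBinCoeff_succ hq β q (n + s)
    have e2 := qBinCoeff_succ hq β 1 n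
    rw [show n + 1 + s = n + s + 1 by omega, ← add_assoc n s 1]
    have e3 : q ^ (n + s + 1) = q ^ n * q ^ (s + 1) := by rw [add_assoc, pow_add]
    have e4 : q * q ^ (n + s) = q ^ n * q ^ (s + 1) := by rw [← pow_succ', e3]
    rw [e3, e4] at e1
    linear_combination qBinCoeff q β 1 n * e1 +
      q ^ (s + 1) * qBinCoeff q β q (n + s + 1) * e2

theorem thetaCoeff_zero_eq : thetaCoeff q β 0 =
    1 + ∑' n, qBinCoeff q β q (n + 1) * qBinCoeff q β 1 (n + 1) := by
  rw [thetaCoeff, (summable_thetaCoeff hq hβ 0).tsum_eq_zero_add]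
  simp [qBinCoeff_zero]

/-- By `qBinCoeff_one_succ` each summand is a difference of consecutive squares of `qBinCoeff q β
q`, which start at `1` and tend to `0`. -/
theorem tsum_qBinCoeff_sq_telescope :
    ∑' n, qBinCoeff q β 1 (n + 1) * (qBinCoeff q β q (n + 1) + qBinCoeff q β q n) = -1 := by
  have ha := summable_norm_qBinCoeff hq hβ q
  have hb := summable_norm_qBinCoeff hq hβ 1
  have hs : Summable fun n =>
      qBinCoeff q β 1 (n + 1) * (qBinCoeff q β q (n + 1) + qBinCoeff q β q n) := by
    simpa only [mul_add, add_zero] using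
      (summable_norm_mul_shift hb ha 1 1).add (summable_norm_mul_shift hb ha 1 0)
  have hD : Tendsto (fun n => -(qBinCoeff q β q n) ^ 2) atTop (𝓝 0) := by
    simpa using ((tendsto_qBinCoeff hq hβ q).pow 2).neg
  rw [tsum_eq_of_telescoping hs (fun n => ?_) hD, qBinCoeff_zero]
  · norm_num
  · rw [qBinCoeff_one_succ hq]
    ring

/-- The left side is the coefficient `θ_{-1}`; the relation reflects `Θ(1/z) = -z Θ(z)`. -/
theorem tsum_qBinCoeff_mul_succ :
    ∑' n, qBinCoeff q β q n * qBinCoeff q β 1 (n + 1) = -thetaCoeff q β 0 := by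
  have ha := summable_norm_qBinCoeff hq hβ q
  have hb := summable_norm_qBinCoeff hq hβ 1
  have h := tsum_qBinCoeff_sq_telescope hq hβ
  have h1 := (summable_norm_mul_shift ha hb 1 1).tsum_add (summable_norm_mul_shift ha hb 0 1)
  simp only [add_zero] at h1
  have h2 : (fun n => qBinCoeff q β 1 (n + 1) * (qBinCoeff q β q (n + 1) + qBinCoeff q β q n)) =
      fun n => qBinCoeff q β q (n + 1) * qBinCoeff q β 1 (n + 1) +
        qBinCoeff q β q n * qBinCoeff q β 1 (n + 1) := by
    funext n; ring
  rw [h2, h1] at h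
  rw [thetaCoeff_zero_eq hq hβ]
  linear_combination h

/-- Since `W = (1 - z) Θ`, the constant term is `θ_0 - θ_{-1}`, and `θ_{-1} = -θ_0`. -/
theorem weightCoeff_zero : weightCoeff q β 0 = 2 * thetaCoeff q β 0 := by
  have hb := summable_norm_qBinCoeff hq hβ 1
  have hs := summable_norm_mul_shift hb hb 0 0
  have ht := (summable_thetaCoeff hq hβ 0).mul_left 2
  have hst := hs.sub ht
  have h : ∑' n, (qBinCoeff q β 1 n * qBinCoeff q β 1 n -
      2 * (qBinCoeff q β q n * qBinCoeff q β 1 n)) = 0 := by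
    rw [Summable.tsum_eq_zero_add (by simpa using hst)]
    have : (fun n => qBinCoeff q β 1 (n + 1) * qBinCoeff q β 1 (n + 1) -
        2 * (qBinCoeff q β q (n + 1) * qBinCoeff q β 1 (n + 1))) = fun n =>
        -(qBinCoeff q β 1 (n + 1) * (qBinCoeff q β q (n + 1) + qBinCoeff q β q n)) := by
      funext n
      linear_combination qBinCoeff q β 1 (n + 1) * qBinCoeff_one_succ hq β n
    rw [this, tsum_neg, tsum_qBinCoeff_sq_telescope hq hβ, qBinCoeff_zero, qBinCoeff_zero]
    norm_num
  have h' := hs.tsum_sub ht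
  simp only [add_zero] at h'
  rw [h, tsum_mul_left] at h'
  simp only [weightCoeff, thetaCoeff, add_zero]
  linear_combination -h'

theorem weightCoeff_succ (s : ℕ) :
    weightCoeff q β (s + 1) = thetaCoeff q β (s + 1) - thetaCoeff q β s := by
  rw [thetaCoeff, thetaCoeff, ← (summable_thetaCoeff hq hβ (s + 1)).tsum_sub
    (summable_thetaCoeff hq hβ s), weightCoeff]
  refine tsum_congr fun n => ?_
  rw [← add_assoc, qBinCoeff_one_succ hq]
  ring

/-- Replacing `β` by `βq` multiplies `Θ` by `(1 - βz)(1 - β/z)`. The new constant term involves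
`θ_{-1}`, `θ_0`, `θ_1`, all multiples of `θ_0`. -/
theorem thetaCoeff_mul_shift :
    thetaCoeff q (β * q) 0 * (1 - β * q) =
      thetaCoeff q β 0 * ((1 + β) * (1 - β ^ 2 * q)) := by
  have ha := summable_norm_qBinCoeff hq hβ q
  have hb := summable_norm_qBinCoeff hq hβ 1
  have ea : ∀ n, qBinCoeff q (β * q) q (n + 1) =
      qBinCoeff q β q (n + 1) - β * qBinCoeff q β q n := by
    intro n
    have h := qBinCoeff_smul q β 1 q (n + 1)
    rw [one_mul] at h
    rw [h, qBinCoeff_one_succ hq]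
    linear_combination -qBinCoeff_succ hq β q n
  have eb : ∀ n, qBinCoeff q (β * q) 1 (n + 1) =
      qBinCoeff q β 1 (n + 1) - β * qBinCoeff q β 1 n := by
    intro n
    have h := qBinCoeff_smul q β 1 q
    simp only [one_mul] at h
    rw [qBinCoeff_one_succ hq, h, h]
    linear_combination -qBinCoeff_succ hq β 1 n
  have s11 := summable_norm_mul_shift ha hb 1 1
  have s00 := (summable_norm_mul_shift ha hb 0 0).mul_left (β ^ 2)
  have s01 := (summable_norm_mul_shift ha hb 0 1).mul_left β
  have s10 := (summable_norm_mul_shift ha hb 1 0).mul_left β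
  have hexp : (fun n => qBinCoeff q (β * q) q (n + 1) * qBinCoeff q (β * q) 1 (n + 1)) = fun n =>
      (qBinCoeff q β q (n + 1) * qBinCoeff q β 1 (n + 1) +
        β ^ 2 * (qBinCoeff q β q (n + 0) * qBinCoeff q β 1 (n + 0))) -
      (β * (qBinCoeff q β q (n + 0) * qBinCoeff q β 1 (n + 1)) +
        β * (qBinCoeff q β q (n + 1) * qBinCoeff q β 1 (n + 0))) := by
    funext n
    rw [ea, eb]
    simp only [add_zero]
    ring
  have hz := thetaCoeff_zero_eq hq hβ
  have h1 : thetaCoeff q β 1 = ∑' n, qBinCoeff q β q (n + 1) * qBinCoeff q β 1 n := rfl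
  have h0 : thetaCoeff q β 0 = ∑' n, qBinCoeff q β q n * qBinCoeff q β 1 n := rfl
  have hm := tsum_qBinCoeff_mul_succ hq hβ
  have hstep := thetaCoeff_succ hq hβ 0
  rw [thetaCoeff_zero_eq hq (norm_mul_lt_one_of_lt_one hq hβ), hexp,
    (s11.add s00).tsum_sub (s01.add s10), s11.tsum_add s00, s01.tsum_add s10, tsum_mul_left,
    tsum_mul_left, tsum_mul_left]
  simp only [add_zero, zero_add, pow_one] at hstep ⊢
  rw [hm, ← h1, ← h0]
  linear_combination -(1 - β * q) * hz - β * hstep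

/-- Each shift contributes `1 + βq^N`, which pairs with `1 - βq^N` into `1 - β²q^{2N}`; hence two
factors of `(β²;q)` per step. -/
theorem thetaCoeff_mul_qPoch (N : ℕ) :
    thetaCoeff q β 0 * qPoch (β ^ 2) q (2 * N) =
      thetaCoeff q (β * q ^ N) 0 * (qPoch β q N * qPoch (β * q) q N) := by
  induction N with
  | zero => simp [qPoch_zero]
  | succ N ih =>
    have hN : ‖β * q ^ N‖ < 1 := (norm_mul_pow_le hq β N).trans_lt hβ
    have h := thetaCoeff_mul_shift hq hN
    rw [show 2 * (N + 1) = 2 * N + 1 + 1 by ring, qPoch_succ (β ^ 2), qPoch_succ (β ^ 2),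
      qPoch_succ β, qPoch_succ (β * q), pow_succ q N, ← mul_assoc β]
    linear_combination (1 - β ^ 2 * q ^ (2 * N)) * (1 - β ^ 2 * q ^ (2 * N + 1)) * ih -
      qPoch β q N * qPoch (β * q) q N * (1 - β * q ^ N) * h

theorem tendsto_thetaCoeff_mul_pow :
    Tendsto (fun N : ℕ => thetaCoeff q (β * q ^ N) 0) atTop (𝓝 (thetaCoeff q 0 0)) := by
  have hlim : Tendsto (fun N : ℕ => β * q ^ N) atTop (𝓝 0) := by
    simpa using (tendsto_pow_atTop_nhds_zero_of_norm_lt_one hq).const_mul β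
  have hcont : ∀ a n, Continuous fun b => qBinCoeff q b a n := by
    intro a n
    unfold qBinCoeff qBinProd
    fun_prop
  have hM : ∀ a : ℂ, Summable fun n => ‖qBinMajorant q ‖β‖ ‖a‖ n‖ := fun a =>
    (summable_qBinMajorant hq (norm_nonneg β) hβ (norm_nonneg a)).norm
  have hMM : Summable fun n => qBinMajorant q ‖β‖ ‖q‖ n * qBinMajorant q ‖β‖ ‖(1 : ℂ)‖ n :=
    (summable_mul_of_summable_norm (hM q) (hM 1)).comp_injective
      (i := fun n : ℕ => (n, n)) fun m n h => congrArg Prod.fst h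
  refine tendsto_tsum_of_dominated_convergence hMM (fun n => ?_) (Eventually.of_forall ?_)
  · exact ((((hcont q _).tendsto 0).comp hlim).mul (((hcont 1 _).tendsto 0).comp hlim))
  · intro N n
    rw [norm_mul]
    have hN := norm_mul_pow_le hq β N
    exact mul_le_mul (norm_qBinCoeff_le hN le_rfl n) (norm_qBinCoeff_le hN le_rfl n)
      (norm_nonneg _) (qBinMajorant_nonneg q (norm_nonneg _) (norm_nonneg _) n)

theorem thetaCoeff_mul_qPochInf :
    thetaCoeff q β 0 * qPochInf (β ^ 2) q =
      thetaCoeff q 0 0 * (qPochInf β q * qPochInf (β * q) q) := by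
  have h2 : Tendsto (fun N : ℕ => 2 * N) atTop atTop :=
    tendsto_id.const_mul_atTop' two_pos
  have hl := ((tendsto_qPoch hq (β ^ 2)).comp h2).const_mul (thetaCoeff q β 0)
  have hr := (tendsto_thetaCoeff_mul_pow hq hβ).mul
    ((tendsto_qPoch hq β).mul (tendsto_qPoch hq (β * q)))
  refine tendsto_nhds_unique hl (hr.congr fun N => ?_)
  exact (thetaCoeff_mul_qPoch hq hβ N).symm

end

/-- The constant `thetaCoeff q 0 0` does not depend on `β`, so it may be read off at `β = q`, where
`(qz;q)_∞ / (βz;q)_∞ = 1` and the constant term is `1`. -/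
theorem thetaCoeff_zero_zero {q : ℂ} (hq : ‖q‖ < 1) : thetaCoeff q 0 0 * qPochInf q q = 1 := by
  have h := thetaCoeff_mul_qPochInf hq hq
  have hz : ∀ n, qBinCoeff q q q (n + 1) = 0 := by
    intro n
    rw [qBinCoeff, qBinProd, Finset.prod_range_succ']
    simp
  have h1 : thetaCoeff q q 0 = 1 := by
    rw [thetaCoeff_zero_eq hq hq]
    simp [hz]
  rw [h1, ← pow_two] at h
  have hne := qPochInf_ne_zero hq (norm_sq_lt_one hq)
  refine mul_right_cancel₀ hne ?_
  linear_combination -h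

/-- The constant term of `(qz, 1/z; q)_∞ / (βz, β/z; q)_∞`. -/
theorem thetaCoeff_zero_mul {q β : ℂ} (hq : ‖q‖ < 1) (hβ : ‖β‖ < 1) :
    thetaCoeff q β 0 * (qPochInf q q * qPochInf (β ^ 2) q) =
      qPochInf β q * qPochInf (β * q) q := by
  linear_combination qPochInf q q * thetaCoeff_mul_qPochInf hq hβ +
    (qPochInf β q * qPochInf (β * q) q) * thetaCoeff_zero_zero hq

theorem thetaCoeff_mul_qPoch_eq {q β : ℂ} (hq : ‖q‖ < 1) (hβ : ‖β‖ < 1) (s : ℕ) :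
    thetaCoeff q β s * qPoch (β * q) q s = thetaCoeff q β 0 * qBinProd q β q s := by
  induction s with
  | zero => simp [qPoch_zero, qBinProd_zero]
  | succ s ih =>
    rw [qPoch_succ, qBinProd_succ]
    have h := thetaCoeff_succ hq hβ s
    linear_combination qPoch (β * q) q s * h + (β - q ^ (s + 1)) * ih

/-! ### The weight on the circle and its integrals against exponentials -/

theorem qBinCoeff_one_self {q : ℂ} (hq : ‖q‖ < 1) (n : ℕ) : qBinCoeff q 1 q n = 1 := by
  rw [qBinCoeff, qBinProd_one, div_self (qPoch_ne_zero hq hq n)]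

theorem norm_exp_two_mul_I (θ : ℝ) : ‖Complex.exp (2 * θ * Complex.I)‖ = 1 := by
  have := Complex.norm_exp_ofReal_mul_I (2 * θ)
  push_cast at this
  exact this

theorem norm_exp_neg_two_mul_I (θ : ℝ) : ‖Complex.exp (-(2 * θ * Complex.I))‖ = 1 := by
  rw [Complex.exp_neg, norm_inv, norm_exp_two_mul_I, inv_one]

theorem hasSum_qBinCoeff_mul_pow {q β : ℂ} (hq : ‖q‖ < 1) (hβ : ‖β‖ < 1) {z : ℂ} (hz : ‖z‖ = 1) :
    HasSum (fun n => z ^ n * qBinCoeff q β 1 n) (qPochInf z q / qPochInf (β * z) q) := by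
  have h := hasSum_qBinCoeff hq (b := β * z) (by rwa [norm_mul, hz, mul_one]) (1 * z)
  rw [one_mul] at h
  simpa only [one_mul, ← qBinCoeff_smul] using h

theorem ultraWeight_eq_mul (q β : ℂ) (θ : ℝ) : ultraWeight q β θ =
    qPochInf (Complex.exp (2 * θ * Complex.I)) q /
        qPochInf (β * Complex.exp (2 * θ * Complex.I)) q *
      (qPochInf (Complex.exp (-(2 * θ * Complex.I))) q /
        qPochInf (β * Complex.exp (-(2 * θ * Complex.I))) q) := by
  rw [ultraWeight, div_mul_div_comm]

theorem ultraWeight_pi_sub (q β : ℂ) (θ : ℝ) :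
    ultraWeight q β (Real.pi - θ) = ultraWeight q β θ := by
  have h1 : Complex.exp (2 * ((Real.pi - θ : ℝ) : ℂ) * Complex.I) =
      Complex.exp (-(2 * θ * Complex.I)) := by
    have : 2 * ((Real.pi - θ : ℝ) : ℂ) * Complex.I =
        2 * Real.pi * Complex.I + -(2 * θ * Complex.I) := by push_cast; ring
    rw [this, Complex.exp_add, Complex.exp_two_pi_mul_I, one_mul]
  have h2 : Complex.exp (-(2 * ((Real.pi - θ : ℝ) : ℂ) * Complex.I)) =
      Complex.exp (2 * θ * Complex.I) := by
    rw [Complex.exp_neg, h1, ← Complex.exp_neg, neg_neg]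
  rw [ultraWeight_eq_mul, ultraWeight_eq_mul, h1, h2, mul_comm]

/-- The double series of the weight function. -/
theorem hasSum_ultraWeight {q β : ℂ} (hq : ‖q‖ < 1) (hβ : ‖β‖ < 1) (θ : ℝ) :
    HasSum (fun p : ℕ × ℕ => qBinCoeff q β 1 p.1 * qBinCoeff q β 1 p.2 *
      Complex.exp ((2 * ((p.1 : ℤ) - (p.2 : ℤ) : ℤ) * Complex.I) * θ)) (ultraWeight q β θ) := by
  have hb := summable_norm_qBinCoeff hq hβ 1
  have h1 := hasSum_qBinCoeff_mul_pow hq hβ (norm_exp_two_mul_I θ)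
  have h2 := hasSum_qBinCoeff_mul_pow hq hβ (norm_exp_neg_two_mul_I θ)
  have n1 : Summable fun n => ‖Complex.exp (2 * θ * Complex.I) ^ n * qBinCoeff q β 1 n‖ := by
    simpa [norm_exp_two_mul_I] using hb
  have n2 : Summable fun n => ‖Complex.exp (-(2 * θ * Complex.I)) ^ n * qBinCoeff q β 1 n‖ := by
    simpa [norm_exp_neg_two_mul_I] using hb
  rw [ultraWeight_eq_mul]
  have hs := summable_mul_of_summable_norm n1 n2
  convert! h1.mul h2 hs using 1
  funext p
  have : 2 * (((p.1 : ℤ) - (p.2 : ℤ) : ℤ) : ℂ) * Complex.I * θ =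
      (p.1 : ℕ) * (2 * θ * Complex.I) + (p.2 : ℕ) * (-(2 * θ * Complex.I)) := by
    push_cast; ring
  rw [this, Complex.exp_add, Complex.exp_nat_mul, Complex.exp_nat_mul]
  ring

theorem continuous_ultraWeight {q β : ℂ} (hq : ‖q‖ < 1) (hβ : ‖β‖ < 1) :
    Continuous (ultraWeight q β) := by
  have hb := summable_norm_qBinCoeff hq hβ 1
  have h : ultraWeight q β = fun θ : ℝ =>
      (∑' n, Complex.exp (2 * θ * Complex.I) ^ n * qBinCoeff q β 1 n) *
        ∑' n, Complex.exp (-(2 * θ * Complex.I)) ^ n * qBinCoeff q β 1 n := by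
    funext θ
    rw [(hasSum_qBinCoeff_mul_pow hq hβ (norm_exp_two_mul_I θ)).tsum_eq,
      (hasSum_qBinCoeff_mul_pow hq hβ (norm_exp_neg_two_mul_I θ)).tsum_eq, ultraWeight_eq_mul]
  rw [h]
  refine (continuous_tsum (fun n => by fun_prop) hb fun n θ => ?_).mul
    (continuous_tsum (fun n => by fun_prop) hb fun n θ => ?_)
  · rw [norm_mul, norm_pow, norm_exp_two_mul_I, one_pow, one_mul]
  · rw [norm_mul, norm_pow, norm_exp_neg_two_mul_I, one_pow, one_mul]

theorem integral_exp_two_int_mul (k : ℤ) :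
    ∫ θ in (0 : ℝ)..Real.pi, Complex.exp ((2 * k * Complex.I) * θ) =
      if k = 0 then (Real.pi : ℂ) else 0 := by
  split_ifs with hk
  · simp [hk]
  · rw [integral_exp_mul_complex (by simp [hk, Complex.I_ne_zero])]
    have : 2 * (k : ℂ) * Complex.I * (Real.pi : ℂ) = k * (2 * Real.pi * Complex.I) := by ring
    rw [this, Complex.exp_int_mul_two_pi_mul_I]
    simp

theorem integral_exp_mul_ultraWeight {q β : ℂ} (hq : ‖q‖ < 1) (hβ : ‖β‖ < 1) (k : ℤ) :
    ∫ θ in (0 : ℝ)..Real.pi, Complex.exp ((2 * k * Complex.I) * θ) * ultraWeight q β θ =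
      ∑' p : ℕ × ℕ, qBinCoeff q β 1 p.1 * qBinCoeff q β 1 p.2 *
        (if k + ((p.1 : ℤ) - (p.2 : ℤ)) = 0 then (Real.pi : ℂ) else 0) := by
  have hb := summable_norm_qBinCoeff hq hβ 1
  have hbb := (summable_mul_of_summable_norm hb hb).norm
  have hexp : ∀ (j : ℤ) (θ : ℝ), ‖Complex.exp ((2 * j * Complex.I) * θ)‖ = 1 := by
    intro j θ
    have := Complex.norm_exp_ofReal_mul_I (2 * j * θ)
    push_cast at this
    rwa [show (2 * j * Complex.I) * θ = 2 * j * (θ : ℂ) * Complex.I by ring]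
  -- On the circle the absolutely summable coefficients dominate the double series, so it integrates
  -- termwise.
  have h := intervalIntegral.hasSum_integral_of_dominated_convergence
    (μ := MeasureTheory.volume) (a := 0) (b := Real.pi)
    (F := fun (p : ℕ × ℕ) (θ : ℝ) => Complex.exp ((2 * k * Complex.I) * θ) *
      (qBinCoeff q β 1 p.1 * qBinCoeff q β 1 p.2 *
        Complex.exp ((2 * ((p.1 : ℤ) - (p.2 : ℤ) : ℤ) * Complex.I) * θ)))
    (f := fun θ => Complex.exp ((2 * k * Complex.I) * θ) * ultraWeight q β θ)
    (fun p _ => ‖qBinCoeff q β 1 p.1 * qBinCoeff q β 1 p.2‖)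
    (fun p => (Continuous.aestronglyMeasurable (by fun_prop)))
    (fun p => Eventually.of_forall fun θ _ => by
      rw [norm_mul, norm_mul _ (Complex.exp _), hexp, hexp, one_mul, mul_one])
    (Eventually.of_forall fun θ _ => hbb) intervalIntegrable_const
    (Eventually.of_forall fun θ _ => (hasSum_ultraWeight hq hβ θ).mul_left _)
  rw [← h.tsum_eq]
  refine tsum_congr fun p => ?_
  rw [← integral_exp_two_int_mul, ← intervalIntegral.integral_const_mul]
  refine intervalIntegral.integral_congr fun θ _ => ?_
  have : (2 * ((k + ((p.1 : ℤ) - (p.2 : ℤ)) : ℤ) : ℂ) * Complex.I) * θ =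
      (2 * k * Complex.I) * θ + (2 * (((p.1 : ℤ) - (p.2 : ℤ) : ℤ) : ℂ) * Complex.I) * θ := by
    push_cast; ring
  simp only [this, Complex.exp_add]
  ring

theorem integral_exp_natCast_mul_ultraWeight {q β : ℂ} (hq : ‖q‖ < 1) (hβ : ‖β‖ < 1) (s : ℕ) :
    ∫ θ in (0 : ℝ)..Real.pi, Complex.exp ((2 * (s : ℤ) * Complex.I) * θ) * ultraWeight q β θ =
      Real.pi * weightCoeff q β s := by
  have hi : Function.Injective fun n : ℕ => (n, n + s) := fun m n h => congrArg Prod.fst h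
  rw [← Int.cast_natCast, integral_exp_mul_ultraWeight hq hβ, weightCoeff, ← tsum_mul_left,
    ← hi.tsum_eq]
  · refine tsum_congr fun n => ?_
    rw [if_pos (by push_cast; ring)]
    ring
  · rintro ⟨m, n⟩ h
    rw [Function.mem_support] at h
    have h' : ((s : ℤ) + ((m : ℤ) - (n : ℤ))) = 0 := by
      by_contra hne
      exact h (mul_eq_zero_of_right _ (if_neg hne))
    exact ⟨m, by simp only [Prod.mk.injEq, true_and]; omega⟩

theorem integral_exp_neg_natCast_mul_ultraWeight {q β : ℂ} (hq : ‖q‖ < 1) (hβ : ‖β‖ < 1) (s : ℕ) :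
    ∫ θ in (0 : ℝ)..Real.pi, Complex.exp ((2 * (-(s : ℤ) : ℤ) * Complex.I) * θ) *
      ultraWeight q β θ = Real.pi * weightCoeff q β s := by
  have hi : Function.Injective fun n : ℕ => (n + s, n) := fun m n h => congrArg Prod.snd h
  rw [integral_exp_mul_ultraWeight hq hβ, weightCoeff, ← tsum_mul_left, ← hi.tsum_eq]
  · refine tsum_congr fun n => ?_
    rw [if_pos (by push_cast; ring)]
    ring
  · rintro ⟨m, n⟩ h
    rw [Function.mem_support] at h
    have h' : (-(s : ℤ) + ((m : ℤ) - (n : ℤ))) = 0 := by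
      by_contra hne
      exact h (mul_eq_zero_of_right _ (if_neg hne))
    exact ⟨n, by simp only [Prod.mk.injEq, and_true]; omega⟩

/-! ### Integrals of a single polynomial against the weight -/

/-- At `β = q` all Fourier coefficients are `1`, so `C_{2s}` is `∑_{|k| ≤ s} e^{2ikθ}` and each step
adds the two outermost exponentials. -/
theorem ultraC_self_even_succ {q : ℂ} (hq : ‖q‖ < 1) (s : ℕ) (θ : ℝ) :
    ultraC q q (2 * (s + 1)) θ = ultraC q q (2 * s) θ +
      (Complex.exp ((2 * ((s + 1 : ℕ) : ℤ) * Complex.I) * θ) +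
        Complex.exp ((2 * (-((s + 1 : ℕ) : ℤ) : ℤ) * Complex.I) * θ)) := by
  simp only [ultraC_eq_sum hq, qBinCoeff_one_self hq, one_mul]
  rw [show 2 * (s + 1) = 2 * s + 1 + 1 by ring, Finset.Nat.sum_antidiagonal_succ,
    Finset.Nat.sum_antidiagonal_succ']
  push_cast
  simp only [add_sub_add_right_eq_sub]
  rw [show ((0 : ℂ) - (2 * s + 1 + 1)) * (θ * Complex.I) =
      2 * -((s : ℂ) + 1) * Complex.I * θ by ring,
    show ((2 * (s : ℂ) + 1 + 1) - 0) * (θ * Complex.I) = 2 * ((s : ℂ) + 1) * Complex.I * θ by ring]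
  ring

theorem integral_ultraC_odd {q : ℂ} (hq : ‖q‖ < 1) (β : ℂ) {n : ℕ} (hn : Odd n) :
    ∫ θ in (0 : ℝ)..Real.pi, ultraC q β n θ * ultraWeight q β θ = 0 := by
  have h := intervalIntegral.integral_comp_sub_left (a := 0) (b := Real.pi)
    (fun θ => ultraC q β n θ * ultraWeight q β θ) Real.pi
  simp only [ultraC_pi_sub hq, ultraWeight_pi_sub, hn.neg_one_pow, sub_self, sub_zero, neg_mul,
    one_mul, intervalIntegral.integral_neg] at h
  exact self_eq_neg.mp h.symm

section
variable {q β : ℂ} (hq : ‖q‖ < 1) (hβ : ‖β‖ < 1)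
include hq hβ

theorem intervalIntegrable_mul_ultraWeight {f : ℝ → ℂ} (hf : Continuous f) :
    IntervalIntegrable (fun θ => f θ * ultraWeight q β θ) MeasureTheory.volume 0 Real.pi :=
  (hf.mul (continuous_ultraWeight hq hβ)).intervalIntegrable _ _

/-- The symmetric partial sums of weight coefficients telescope through `weightCoeff_succ`. -/
theorem integral_ultraC_self_even (s : ℕ) :
    ∫ θ in (0 : ℝ)..Real.pi, ultraC q q (2 * s) θ * ultraWeight q β θ =
      2 * Real.pi * thetaCoeff q β s := by
  induction s with
  | zero =>
    have h := integral_exp_natCast_mul_ultraWeight hq hβ 0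
    simp only [Nat.cast_zero, Int.cast_zero, mul_zero, zero_mul, Complex.exp_zero] at h
    simp only [mul_zero, ultraC_zero hq, h, weightCoeff_zero hq hβ]
    ring
  | succ s ih =>
    simp only [ultraC_self_even_succ hq, add_mul]
    rw [intervalIntegral.integral_add, intervalIntegral.integral_add, ih,
      integral_exp_natCast_mul_ultraWeight hq hβ, integral_exp_neg_natCast_mul_ultraWeight hq hβ,
      weightCoeff_succ hq hβ]
    · ring
    · exact intervalIntegrable_mul_ultraWeight hq hβ (by fun_prop)
    · exact intervalIntegrable_mul_ultraWeight hq hβ (by fun_prop)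
    · exact intervalIntegrable_mul_ultraWeight hq hβ (continuous_ultraC hq q _)
    · exact (intervalIntegrable_mul_ultraWeight hq hβ (by fun_prop)).add
        (intervalIntegrable_mul_ultraWeight hq hβ (by fun_prop))

/-- Integrating the connection formula against a continuous function. -/
theorem integral_connection (γ : ℂ) {f : ℝ → ℂ} (hf : Continuous f) (n : ℕ) :
    ∫ θ in (0 : ℝ)..Real.pi, ultraC q γ n θ * f θ = ∑ k ∈ Finset.range (n / 2 + 1),
      (qBinProd q β γ k * qPoch γ q (n - k) * (1 - β * q ^ (n - 2 * k))) /
        (qPoch q q k * qPoch (β * q) q (n - k) * (1 - β)) *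
          ∫ θ in (0 : ℝ)..Real.pi, ultraC q β (n - 2 * k) θ * f θ := by
  simp only [ultraC_connection hq hβ γ, Finset.sum_mul, mul_assoc _ (ultraC _ _ _ _)]
  rw [intervalIntegral.integral_finsetSum]
  · simp only [intervalIntegral.integral_const_mul]
  · intro k _
    exact (((continuous_ultraC hq β _).mul hf).const_mul _).intervalIntegrable _ _

theorem one_sub_ne_zero_of_norm_lt_one : 1 - β ≠ 0 := by
  simpa using one_sub_mul_pow_ne_zero hq hβ 0

/-- Integrate Rogers' formula with `γ = q`. Intermediate terms vanish by induction and the `C_0`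
term already equals the left side, so the leading term, whose coefficient is nonzero, must vanish.
-/
theorem integral_ultraC_even (s : ℕ) :
    ∫ θ in (0 : ℝ)..Real.pi, ultraC q β (2 * (s + 1)) θ * ultraWeight q β θ = 0 := by
  induction s using Nat.strong_induction_on with
  | _ s ih =>
    have hβq := norm_mul_lt_one_of_lt_one hq hβ
    have h1 := one_sub_ne_zero_of_norm_lt_one hq hβ
    have h := integral_connection hq hβ q (continuous_ultraWeight hq hβ) (2 * (s + 1))
    rw [integral_ultraC_self_even hq hβ, Nat.mul_div_cancel_left _ two_pos,
      Finset.sum_range_succ, Nat.sub_self, Finset.sum_eq_single 0] at h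
    · have h0 := integral_ultraC_self_even hq hβ 0
      simp only [mul_zero, ultraC_zero hq, one_mul] at h0
      simp only [ultraC_zero hq, one_mul, h0, mul_zero, Nat.sub_zero, pow_zero, mul_one,
        show 2 * (s + 1) - (s + 1) = s + 1 by omega, qBinProd_zero, qPoch_zero] at h
      have ht := thetaCoeff_mul_qPoch_eq hq hβ (s + 1)
      have n1 := qPoch_ne_zero hq hβq (s + 1)
      have n2 := qPoch_ne_zero hq hq (s + 1)
      -- The `C_0` term is `2πθ_{s+1}`, by the closed form of `θ_{s+1} / θ_0`.
      have ht' : qBinProd q β q (s + 1) * qPoch q q (s + 1) * (1 - β) /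
          (qPoch q q (s + 1) * qPoch (β * q) q (s + 1) * (1 - β)) *
            (2 * Real.pi * thetaCoeff q β 0) = 2 * Real.pi * thetaCoeff q β (s + 1) := by
        rw [div_mul_eq_mul_div, div_eq_iff (mul_ne_zero (mul_ne_zero n2 n1) h1)]
        linear_combination -2 * Real.pi * qPoch q q (s + 1) * (1 - β) * ht
      rw [ht', right_eq_add] at h
      refine (mul_eq_zero.mp h).resolve_left (div_ne_zero ?_ ?_)
      · exact mul_ne_zero (qPoch_ne_zero hq hq _) (one_sub_mul_pow_ne_zero hq hβ _)
      · exact mul_ne_zero (qPoch_ne_zero hq hβq _) h1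
    · intro k hk hk0
      rw [Finset.mem_range] at hk
      rw [show 2 * (s + 1) - 2 * k = 2 * (s - k + 1) by omega, ih (s - k) (by omega), mul_zero]
    · simp

theorem integral_ultraC_zero :
    ∫ θ in (0 : ℝ)..Real.pi, ultraC q β 0 θ * ultraWeight q β θ =
      2 * Real.pi * thetaCoeff q β 0 := by
  have h0 := integral_ultraC_self_even hq hβ 0
  simpa only [mul_zero, ultraC_zero hq] using h0

theorem integral_ultraC_succ (n : ℕ) :
    ∫ θ in (0 : ℝ)..Real.pi, ultraC q β (n + 1) θ * ultraWeight q β θ = 0 := by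
  rcases Nat.even_or_odd' (n + 1) with ⟨s, h | h⟩
  · obtain ⟨t, rfl⟩ : ∃ t, s = t + 1 := ⟨s - 1, by omega⟩
    rw [h]
    exact integral_ultraC_even hq hβ t
  · exact integral_ultraC_odd hq β ⟨s, h⟩

end

/-! ### Orthogonality, norms and the connection integral -/

/-- The moments of a pair of `q`-ultraspherical polynomials with the same parameter. -/
noncomputable def ultraGram (q β : ℂ) (m n : ℕ) : ℂ :=
  ∫ θ in (0 : ℝ)..Real.pi, ultraC q β m θ * (ultraC q β n θ * ultraWeight q β θ)

theorem ultraGram_comm (q β : ℂ) (m n : ℕ) : ultraGram q β m n = ultraGram q β n m := by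
  simp only [ultraGram, mul_left_comm]

/-- The coefficient of the lower term in the three-term recurrence. -/
noncomputable def ultraLower (q β : ℂ) (n : ℕ) : ℂ :=
  if n = 0 then 0 else 1 - β ^ 2 * q ^ (n - 1)

theorem ultraC_recurrence' {q : ℂ} (hq : ‖q‖ < 1) (β : ℂ) (n : ℕ) (θ : ℝ) :
    (1 - β * q ^ n) * (2 * Complex.cos θ) * ultraC q β n θ =
      (1 - q ^ (n + 1)) * ultraC q β (n + 1) θ + ultraLower q β n * ultraC q β (n - 1) θ := by
  rcases n with _ | n
  · have h := qBinCoeff_succ hq 1 β 0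
    rw [qBinCoeff_zero] at h
    rw [ultraC_zero hq, ultraC_eq_sum hq, Finset.Nat.sum_antidiagonal_succ,
      Finset.Nat.antidiagonal_zero, Finset.sum_singleton, ultraLower, if_pos rfl, Complex.cos,
      qBinCoeff_zero]
    push_cast
    rw [show ((0 : ℂ) - 1) * (θ * Complex.I) = -θ * Complex.I by ring,
      show ((1 : ℂ) - 0) * (θ * Complex.I) = θ * Complex.I by ring]
    simp only [zero_add, pow_zero, pow_one] at h ⊢
    linear_combination -(Complex.exp (θ * Complex.I) + Complex.exp (-θ * Complex.I)) * h
  · simpa only [ultraLower, Nat.succ_ne_zero, if_false, Nat.add_sub_cancel] using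
      ultraC_recurrence hq β n θ

section
variable {q β : ℂ} (hq : ‖q‖ < 1) (hβ : ‖β‖ < 1)
include hq hβ

theorem integral_cos_mul_ultraGram (m n : ℕ) :
    (1 - β * q ^ m) * ∫ θ in (0 : ℝ)..Real.pi,
        2 * Complex.cos θ * (ultraC q β m θ * (ultraC q β n θ * ultraWeight q β θ)) =
      (1 - q ^ (m + 1)) * ultraGram q β (m + 1) n +
        ultraLower q β m * ultraGram q β (m - 1) n := by
  have hc : ∀ m, IntervalIntegrable
      (fun θ => ultraC q β m θ * (ultraC q β n θ * ultraWeight q β θ))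
      MeasureTheory.volume 0 Real.pi := fun m =>
    ((continuous_ultraC hq β m).mul ((continuous_ultraC hq β n).mul
      (continuous_ultraWeight hq hβ))).intervalIntegrable _ _
  rw [ultraGram, ultraGram, ← intervalIntegral.integral_const_mul,
    ← intervalIntegral.integral_const_mul, ← intervalIntegral.integral_const_mul,
    ← intervalIntegral.integral_add ((hc _).const_mul _) ((hc _).const_mul _)]
  refine intervalIntegral.integral_congr fun θ _ => ?_
  linear_combination (ultraC q β n θ * ultraWeight q β θ) * ultraC_recurrence' hq β m θ

/-- Multiplication by `2 cos θ` can be absorbed by either factor. At index `0` the truncated `n - 1`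
is harmless because `ultraLower` is `0` there. -/
theorem ultraGram_recurrence (m n : ℕ) :
    (1 - β * q ^ n) * ((1 - q ^ (m + 1)) * ultraGram q β (m + 1) n +
        ultraLower q β m * ultraGram q β (m - 1) n) =
      (1 - β * q ^ m) * ((1 - q ^ (n + 1)) * ultraGram q β m (n + 1) +
        ultraLower q β n * ultraGram q β m (n - 1)) := by
  have h1 := integral_cos_mul_ultraGram hq hβ m n
  have h2 := integral_cos_mul_ultraGram hq hβ n m
  simp only [mul_left_comm (ultraC q β n _)] at h2
  rw [ultraGram_comm q β m (n + 1), ultraGram_comm q β m (n - 1), ← h1, ← h2]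
  ring

/-- Induction on the smaller index: the recurrence expresses the entry `(m, n + 1)` through `(m ± 1,
n)` and `(m, n - 1)`, which still lie strictly off the diagonal. -/
theorem ultraGram_of_lt {m n : ℕ} (h : n < m) : ultraGram q β m n = 0 := by
  induction n using Nat.strong_induction_on generalizing m with
  | _ n ih =>
    rcases n with _ | n
    · obtain ⟨m, rfl⟩ : ∃ t, m = t + 1 := ⟨m - 1, by omega⟩
      simpa only [ultraGram, ultraC_zero hq, one_mul] using integral_ultraC_succ hq hβ m
    · have hr := ultraGram_recurrence hq hβ m n
      rw [ih n n.lt_succ_self (show n < m + 1 by omega),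
        ih n n.lt_succ_self (show n < m - 1 by omega)] at hr
      have hl : ultraLower q β n * ultraGram q β m (n - 1) = 0 := by
        rcases n with _ | n
        · simp [ultraLower]
        · rw [Nat.add_sub_cancel, ih n (by omega) (by omega), mul_zero]
      rw [hl, mul_zero, mul_zero, add_zero, add_zero, mul_zero] at hr
      have h1 := one_sub_mul_pow_ne_zero hq hβ m
      have h2 := one_sub_pow_succ_ne_zero hq n
      exact (mul_eq_zero.mp ((mul_eq_zero.mp hr.symm).resolve_left h1)).resolve_left h2

theorem ultraGram_of_ne {m n : ℕ} (h : m ≠ n) : ultraGram q β m n = 0 := by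
  rcases lt_or_gt_of_ne h with h | h
  · rw [ultraGram_comm, ultraGram_of_lt hq hβ h]
  · exact ultraGram_of_lt hq hβ h

theorem ultraH_succ (n : ℕ) :
    ultraH q β (n + 1) * ((1 - β ^ 2 * q ^ n) * (1 - β * q ^ n)) =
      ultraH q β n * ((1 - q ^ (n + 1)) * (1 - β * q ^ (n + 1))) := by
  have h1 := qPochInf_ne_zero hq hβ
  have h2 := qPochInf_ne_zero hq (norm_mul_lt_one_of_lt_one hq hβ)
  have h3 := qPoch_ne_zero hq (norm_sq_lt_one hβ) n
  have h4 := one_sub_mul_pow_ne_zero hq (norm_sq_lt_one hβ) n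
  have h5 := one_sub_ne_zero_of_norm_lt_one hq hβ
  have h6 : (Real.pi : ℂ) ≠ 0 := by exact_mod_cast Real.pi_ne_zero
  rw [ultraH, ultraH, qPoch_self_succ, qPoch_succ]
  field_simp

/-- The recurrence at `(n + 1, n)` keeps only diagonal entries and yields the inverse of the ratio
in `ultraH_succ`; the base case is the evaluation of `θ_0`. -/
theorem ultraGram_self_mul_ultraH (n : ℕ) : ultraGram q β n n * ultraH q β n = 1 := by
  have hsq := norm_sq_lt_one hβ
  induction n with
  | zero =>
    have h0 := integral_ultraC_zero hq hβ
    have ht := thetaCoeff_zero_mul hq hβ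
    have h1 := qPochInf_ne_zero hq hβ
    have h2 := qPochInf_ne_zero hq (norm_mul_lt_one_of_lt_one hq hβ)
    have h5 := one_sub_ne_zero_of_norm_lt_one hq hβ
    have h6 : (Real.pi : ℂ) ≠ 0 := by exact_mod_cast Real.pi_ne_zero
    have hg : ultraGram q β 0 0 = 2 * Real.pi * thetaCoeff q β 0 := by
      rw [← h0]
      simp only [ultraGram, ultraC_zero hq, one_mul]
    rw [hg, ultraH, qPoch_zero, qPoch_zero, pow_zero, mul_one]
    field_simp
    linear_combination ht
  | succ n ih =>
    have hr := ultraGram_recurrence hq hβ (n + 1) n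
    rw [ultraGram_of_ne hq hβ (show n + 1 + 1 ≠ n by omega),
      ultraGram_of_ne hq hβ (show n + 1 ≠ n - 1 by omega), ultraLower, if_neg (Nat.succ_ne_zero n),
      Nat.add_sub_cancel, mul_zero, mul_zero, zero_add, add_zero] at hr
    have hh := ultraH_succ hq hβ n
    have h1 := one_sub_mul_pow_ne_zero hq hsq n
    have h2 := one_sub_mul_pow_ne_zero hq hβ n
    refine mul_right_cancel₀ (mul_ne_zero h1 h2) ?_
    linear_combination ultraGram q β (n + 1) (n + 1) * hh - ultraH q β n * hr +
      (1 - β ^ 2 * q ^ n) * (1 - β * q ^ n) * ih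

/-- By orthogonality only the term of Rogers' formula with `m - 2k = n` survives; such a `k` exists
exactly when the parities agree and `n ≤ m`. -/
theorem integral_ultraC_mul_ultraC (γ : ℂ) (m n : ℕ) :
    ∫ θ in (0 : ℝ)..Real.pi, ultraC q γ m θ * ultraC q β n θ * ultraWeight q β θ =
      if m ≡ n [MOD 2] ∧ n ≤ m then
        ((1 - β * q ^ n) * connFactor q β γ ((m - n) / 2) * qPoch γ q ((m + n) / 2)) /
          ((1 - β) * ultraH q β n * qPoch q q ((m - n) / 2) * qPoch (q * β) q ((m + n) / 2))
      else 0 := by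
  simp only [mul_assoc (ultraC q γ m _)]
  rw [integral_connection (f := fun θ => ultraC q β n θ * ultraWeight q β θ) hq hβ γ
    ((continuous_ultraC hq β n).mul (continuous_ultraWeight hq hβ))]
  change ∑ k ∈ Finset.range (m / 2 + 1), _ * ultraGram q β (m - 2 * k) n = _
  split_ifs with h
  · obtain ⟨hmod, hle⟩ := h
    obtain ⟨k, rfl⟩ : ∃ k, m = n + 2 * k := ⟨(m - n) / 2, by unfold Nat.ModEq at hmod; omega⟩
    rw [Finset.sum_eq_single k]
    · have hg := ultraGram_self_mul_ultraH hq hβ n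
      have hH : ultraH q β n ≠ 0 := right_ne_zero_of_mul_eq_one hg
      rw [show n + 2 * k - 2 * k = n by omega, show n + 2 * k - k = n + k by omega,
        show (n + 2 * k - n) / 2 = k by omega, show (n + 2 * k + n) / 2 = n + k by omega,
        connFactor_eq, mul_comm q β, eq_div_of_mul_eq hH hg, div_mul_div_comm]
      congr 1 <;> ring
    · intro j hj hjk
      rw [Finset.mem_range] at hj
      rw [ultraGram_of_ne hq hβ (by omega), mul_zero]
    · intro hk
      rw [Finset.mem_range] at hk
      omega
  · refine Finset.sum_eq_zero fun k hk => ?_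
    rw [Finset.mem_range] at hk
    rw [ultraGram_of_ne hq hβ, mul_zero]
    rintro rfl
    exact h ⟨by unfold Nat.ModEq; omega, by omega⟩

end

theorem theorem1p2 (q β γ : ℂ) (hq : ‖q‖ < 1) (hβ : ‖β‖ < 1) :
    (∀ m n : ℕ,
      IntervalIntegrable (fun θ : ℝ => ultraC q γ m θ * ultraC q β n θ * ultraWeight q β θ)
          MeasureTheory.volume 0 Real.pi ∧
        ∫ θ in (0 : ℝ)..Real.pi, ultraC q γ m θ * ultraC q β n θ * ultraWeight q β θ =
          if m ≡ n [MOD 2] ∧ n ≤ m then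
            ((1 - β * q ^ n) * connFactor q β γ ((m - n) / 2) * qPoch γ q ((m + n) / 2)) /
              ((1 - β) * ultraH q β n * qPoch q q ((m - n) / 2) * qPoch (q * β) q ((m + n) / 2))
          else 0) ∧
    (∀ (n : ℕ) (θ : ℝ),
      ultraC q γ n θ =
        ∑ k ∈ Finset.range (n / 2 + 1),
          (connFactor q β γ k * qPoch γ q (n - k) * (1 - β * q ^ (n - 2 * k))) /
              (qPoch q q k * qPoch (β * q) q (n - k) * (1 - β)) *
            ultraC q β (n - 2 * k) θ) := by
  refine ⟨fun m n => ⟨?_, integral_ultraC_mul_ultraC hq hβ γ m n⟩, fun n θ => ?_⟩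
  · exact intervalIntegrable_mul_ultraWeight hq hβ
      ((continuous_ultraC hq γ m).mul (continuous_ultraC hq β n))
  · simp only [connFactor_eq]
    exact ultraC_connection hq hβ γ n θ
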